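/- Let $\mathfrak u$ be a finite-dimensional real vector space, $A\in\operatorname{End}(\mathfrak u)$, and let $\mathfrak g_A=\mathbb R f_1\ltimes_A\mathfrak u$ be the almost abelian Lie algebra with bracket $[\mathfrak u,\mathfrak u]=0$ and $[f_1,u]=Au$ for $u\in\mathfrak u$. A symplectic form on $\mathfrak g_A$ is a non-degenerate $2$-form $\omega\in\bigwedge^2\mathfrak g_A^*$ with $d\omega=0$, where $d$ is the differential of the standard cochain complex $\bigwedge^*\mathfrak g_A^*$, whose cohomology is denoted $H^*(\mathfrak g_A)$. Write $\dim\mathfrak g_A=2n$. One says that $\omega$ satisfies the hard-Lefschetz condition if the operators $L_j:H^{n-j}(\mathfrak g_A)\to H^{n+j}(\mathfrak g_A)$, $[\alpha]\mapsto[\omega^j\wedge\alpha]$, are isomorphisms for all $0\le j\le n$, and that the condition fails at degree $k\le n$ if $L_{n-k}:H^k(\mathfrak g_A)\to H^{2n-k}(\mathfrak g_A)$ has nontrivial kernel. Assume that $\mathfrak g_A$ is unimodular (i.e. $\operatorname{tr}(\operatorname{ad}_x)=0$ for all $x$) and carries a symplectic form $\omega'$. Let $f_2\in\mathfrak u$ be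 the vector with $\omega'(f_1,f_2)=1$ and $\omega'(f_2,\mathfrak u)=0$, let $\mathfrak u_0\subset\mathfrak u$ be the $\omega'$-orthogonal complement of $\{f_1,f_2\}$, so that $\mathfrak u=\mathbb R f_2\oplus\mathfrak u_0$, and write $Ax=v(x)f_2+A_0x$ for $x\in\mathfrak u_0$, with $v\in\mathfrak u_0^*$ and $A_0\in\operatorname{End}(\mathfrak u_0)$. Let $V_0\subset\mathfrak u_0$ be the generalized eigenspace of $A_0$ for the eigenvalue $0$, let $W_0=\mathbb R f_2\oplus V_0$, and let $M=A|_{W_0}$. Assume that $0\in\operatorname{spec}(A_0)$. If $M\neq0$ (in particular, if $v|_{V_0}\neq0$), then every symplectic form $\omega$ on $\mathfrak g_A$ fails to satisfy the hard-Lefschetz condition; moreover, the failure occurs at degree $1$. -/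

import Mathlib

noncomputable section

namespace LieForms

/-! ### The cochain complex of a finite-dimensional real Lie algebra -/

section Complex

variable (𝔤 : Type*) [LieRing 𝔤] [LieAlgebra ℝ 𝔤]

/-- The algebra `⋀* 𝔤*` of forms on `𝔤`; the product is the wedge product, and the `k`-forms are
the elements of the submodule `⋀[ℝ]^k (Module.Dual ℝ 𝔤)`. -/
abbrev Form : Type _ := ExteriorAlgebra ℝ (Module.Dual ℝ 𝔤)

/-- The submodule `⋀^k 𝔤*` of `k`-forms. -/
abbrev kForms (k : ℕ) : Submodule ℝ (Form 𝔤) := ⋀[ℝ]^k (Module.Dual ℝ 𝔤)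

variable {𝔤}

/-- The interior product `ι_x` by a vector `x`. -/
def interiorProd (x : 𝔤) : Form 𝔤 →ₗ[ℝ] Form 𝔤 :=
  CliffordAlgebra.contractLeft (Module.Dual.eval ℝ 𝔤 x)

/-- The value `α(x, y)` of (the degree two part of) a form; on `2`-forms it is determined by
`(θ ∧ η)(x, y) = θ(x) η(y) - θ(y) η(x)`. -/
def evalTwo (α : Form 𝔤) (x y : 𝔤) : ℝ :=
  ExteriorAlgebra.algebraMapInv (interiorProd y (interiorProd x α))

theorem evalTwo_ι_mul_ι (θ η : Module.Dual ℝ 𝔤) (x y : 𝔤) :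
    evalTwo (ExteriorAlgebra.ι ℝ θ * ExteriorAlgebra.ι ℝ η) x y = θ x * η y - θ y * η x := by
  have h1 : interiorProd x (ExteriorAlgebra.ι ℝ θ * ExteriorAlgebra.ι ℝ η) =
      θ x • ExteriorAlgebra.ι ℝ η - ExteriorAlgebra.ι ℝ θ * algebraMap ℝ _ (η x) := by
    simp [interiorProd, CliffordAlgebra.contractLeft_ι_mul, CliffordAlgebra.contractLeft_ι]
  have h2 : interiorProd y (interiorProd x (ExteriorAlgebra.ι ℝ θ * ExteriorAlgebra.ι ℝ η)) =
      algebraMap ℝ _ (θ x * η y - θ y * η x) := by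
    rw [h1, interiorProd, map_sub, map_smul, CliffordAlgebra.contractLeft_mul_algebraMap,
      CliffordAlgebra.contractLeft_ι, CliffordAlgebra.contractLeft_ι]
    simp [Algebra.smul_def]
  rw [evalTwo, h2, ExteriorAlgebra.algebraMap_leftInverse]

theorem evalTwo_add_right (α : Form 𝔤) (x y z : 𝔤) :
    evalTwo α x (y + z) = evalTwo α x y + evalTwo α x z := by
  simp [evalTwo, interiorProd]

theorem evalTwo_smul_right (α : Form 𝔤) (c : ℝ) (x y : 𝔤) :
    evalTwo α x (c • y) = c * evalTwo α x y := by
  simp [evalTwo, interiorProd]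

theorem involute_of_mem_two {α : Form 𝔤} (hα : α ∈ kForms 𝔤 2) :
    CliffordAlgebra.involute α = α := by
  rw [kForms, ExteriorAlgebra.exteriorPower, pow_two] at hα
  induction hα using Submodule.mul_induction_on' with
  | mem_mul_mem a ha b hb =>
    obtain ⟨θ, rfl⟩ := ha
    obtain ⟨η, rfl⟩ := hb
    rw [map_mul, ExteriorAlgebra.ι, CliffordAlgebra.involute_ι, CliffordAlgebra.involute_ι,
      neg_mul_neg]
  | add a _ b _ ha hb => rw [map_add, ha, hb]

variable [Module.Finite ℝ 𝔤]

/-- The exterior derivative of a `1`-form `θ`: the `2`-form `(x, y) ↦ -θ([x, y])`, written in a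
basis `b` of `𝔤` as `-1/2 ∑ i j, θ([b i, b j]) b^i ∧ b^j`. -/
def dOne : Module.Dual ℝ 𝔤 →ₗ[ℝ] Form 𝔤 where
  toFun θ := -(1 / 2 : ℝ) • ∑ i, ∑ j,
    θ ⁅Module.finBasis ℝ 𝔤 i, Module.finBasis ℝ 𝔤 j⁆ •
      (ExteriorAlgebra.ι ℝ ((Module.finBasis ℝ 𝔤).coord i) *
        ExteriorAlgebra.ι ℝ ((Module.finBasis ℝ 𝔤).coord j))
  map_add' θ η := by
    simp only [LinearMap.add_apply, add_smul, Finset.sum_add_distrib, smul_add]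
  map_smul' c θ := by
    simp only [LinearMap.smul_apply, smul_assoc, ← Finset.smul_sum, RingHom.id_apply]
    rw [smul_comm]

/-- The defining property `dθ(x, y) = -θ([x, y])`. -/
theorem evalTwo_dOne (θ : Module.Dual ℝ 𝔤) (x y : 𝔤) :
    evalTwo (dOne θ) x y = -θ ⁅x, y⁆ := by
  set b := Module.finBasis ℝ 𝔤 with hb
  have h1 : evalTwo (dOne θ) x y = -(1 / 2 : ℝ) * ∑ i, ∑ j, θ ⁅b i, b j⁆ *
      (b.coord i x * b.coord j y - b.coord i y * b.coord j x) := by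
    simp only [← evalTwo_ι_mul_ι]
    simp [evalTwo, dOne, map_sum, hb]
  have h2 : ∀ u v : 𝔤, ∑ i, ∑ j, θ ⁅b i, b j⁆ * (b.coord i u * b.coord j v) = θ ⁅u, v⁆ := by
    intro u v
    conv_rhs => rw [← b.sum_repr u, ← b.sum_repr v]
    simp only [sum_lie, lie_sum, smul_lie, lie_smul, map_sum, map_smul,
      smul_eq_mul, Module.Basis.coord_apply]
    rw [Finset.sum_comm]
    refine Finset.sum_congr rfl fun i _ => ?_
    rw [Finset.mul_sum]
    refine Finset.sum_congr rfl fun j _ => ?_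
    ring
  rw [h1]
  simp only [mul_sub, Finset.sum_sub_distrib, h2]
  rw [← lie_skew x y, map_neg]
  ring

theorem dOne_mem (θ : Module.Dual ℝ 𝔤) : dOne θ ∈ kForms 𝔤 2 := by
  refine Submodule.smul_mem _ _ (Submodule.sum_mem _ fun i _ => Submodule.sum_mem _ fun j _ =>
    Submodule.smul_mem _ _ ?_)
  rw [kForms, ExteriorAlgebra.exteriorPower, pow_two]
  exact Submodule.mul_mem_mul ⟨_, rfl⟩ ⟨_, rfl⟩

theorem dOne_mul_ι (θ η : Module.Dual ℝ 𝔤) :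
    dOne θ * ExteriorAlgebra.ι ℝ η = ExteriorAlgebra.ι ℝ η * dOne θ := by
  have key : ∀ a b c : Module.Dual ℝ 𝔤,
      ExteriorAlgebra.ι ℝ a * ExteriorAlgebra.ι ℝ b * ExteriorAlgebra.ι ℝ c =
        ExteriorAlgebra.ι ℝ c * (ExteriorAlgebra.ι ℝ a * ExteriorAlgebra.ι ℝ b) := by
    intro a b c
    rw [mul_assoc, eq_neg_of_add_eq_zero_left (ExteriorAlgebra.ι_add_mul_swap b c), mul_neg,
      ← mul_assoc, eq_neg_of_add_eq_zero_left (ExteriorAlgebra.ι_add_mul_swap a c), neg_mul,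
      neg_neg, mul_assoc]
  simp only [dOne, LinearMap.coe_mk, AddHom.coe_mk, smul_mul_assoc, mul_smul_comm,
    Finset.sum_mul, Finset.mul_sum, key]

/-- The recursion step `d(θ ∧ α) = dθ ∧ α - θ ∧ dα`. -/
def extDerivStep : Module.Dual ℝ 𝔤 →ₗ[ℝ] Form 𝔤 × Form 𝔤 →ₗ[ℝ] Form 𝔤 :=
  ((LinearMap.mul ℝ (Form 𝔤)).comp dOne).compl₂ (LinearMap.fst ℝ _ _) -
    ((LinearMap.mul ℝ (Form 𝔤)).comp (ExteriorAlgebra.ι ℝ)).compl₂ (LinearMap.snd ℝ _ _)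

theorem extDerivStep_apply (θ : Module.Dual ℝ 𝔤) (p : Form 𝔤 × Form 𝔤) :
    extDerivStep θ p = dOne θ * p.1 - ExteriorAlgebra.ι ℝ θ * p.2 := rfl

theorem extDerivStep_step (θ : Module.Dual ℝ 𝔤) (α β : Form 𝔤) :
    extDerivStep θ (ExteriorAlgebra.ι ℝ θ * α, extDerivStep θ (α, β)) =
      (0 : QuadraticForm ℝ (Module.Dual ℝ 𝔤)) θ • β := by
  simp only [extDerivStep_apply, mul_sub, ← mul_assoc, dOne_mul_ι, ExteriorAlgebra.ι_sq_zero]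
  simp

/-- The exterior derivative `d` on `⋀* 𝔤*`: the antiderivation that extends `dOne`. -/
def extD : Form 𝔤 →ₗ[ℝ] Form 𝔤 :=
  CliffordAlgebra.foldr' 0 extDerivStep extDerivStep_step 0

theorem extD_algebraMap (r : ℝ) : extD (algebraMap ℝ (Form 𝔤) r) = 0 := by
  rw [extD, CliffordAlgebra.foldr'_algebraMap, smul_zero]

theorem extD_ι_mul (θ : Module.Dual ℝ 𝔤) (α : Form 𝔤) :
    extD (ExteriorAlgebra.ι ℝ θ * α) = dOne θ * α - ExteriorAlgebra.ι ℝ θ * extD α := by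
  rw [extD, ExteriorAlgebra.ι, CliffordAlgebra.foldr'_ι_mul, extDerivStep_apply]

theorem extD_ι (θ : Module.Dual ℝ 𝔤) : extD (ExteriorAlgebra.ι ℝ θ) = dOne θ := by
  rw [extD, ExteriorAlgebra.ι, CliffordAlgebra.foldr'_ι, extDerivStep_apply]
  simp

/-- The Leibniz rule `d(α ∧ β) = dα ∧ β + (-1)^k α ∧ dβ` for `α` of degree `k`; the sign is the
grade involution. -/
theorem extD_mul (α β : Form 𝔤) :
    extD (α * β) = extD α * β + CliffordAlgebra.involute α * extD β := by
  induction α using CliffordAlgebra.left_induction with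
  | algebraMap r =>
    have h := extD_algebraMap (𝔤 := 𝔤) r
    rw [AlgHom.commutes, ← Algebra.smul_def, map_smul, ← Algebra.smul_def]
    erw [h]
    rw [zero_mul, zero_add]
  | add a b ha hb =>
    rw [add_mul, map_add, ha, hb, map_add, map_add, add_mul, add_mul]
    abel
  | ι_mul a θ ha =>
    change extD (ExteriorAlgebra.ι ℝ θ * a * β) = extD (ExteriorAlgebra.ι ℝ θ * a) * β +
      CliffordAlgebra.involute (ExteriorAlgebra.ι ℝ θ * a) * extD β
    have hi : CliffordAlgebra.involute (ExteriorAlgebra.ι ℝ θ * a) =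
        -(ExteriorAlgebra.ι ℝ θ * CliffordAlgebra.involute a) := by
      rw [map_mul, ExteriorAlgebra.ι, CliffordAlgebra.involute_ι, neg_mul]
    rw [hi, mul_assoc, extD_ι_mul, extD_ι_mul, ha]
    noncomm_ring

variable (𝔤)

/-- The space of closed `k`-forms. -/
def cocycles (k : ℕ) : Submodule ℝ (Form 𝔤) := LinearMap.ker extD ⊓ kForms 𝔤 k

/-- The space of exact `k`-forms. -/
def coboundaries (k : ℕ) : Submodule ℝ (Form 𝔤) := LinearMap.range extD ⊓ kForms 𝔤 k

/-- The cohomology `H^k(𝔤)`: closed `k`-forms modulo exact `k`-forms. -/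
abbrev Cohomology (k : ℕ) : Type _ :=
  cocycles 𝔤 k ⧸ (coboundaries 𝔤 k).submoduleOf (cocycles 𝔤 k)

/-- A symplectic form on `𝔤`: a closed non-degenerate `2`-form. -/
structure SymplecticForm where
  /-- The underlying form. -/
  form : Form 𝔤
  mem_two : form ∈ kForms 𝔤 2
  closed : extD form = 0
  nondegenerate : ∀ x : 𝔤, (∀ y : 𝔤, evalTwo form x y = 0) → x = 0

/-- `𝔤` is unimodular: `tr(ad x) = 0` for all `x`. -/
def IsUnimodular : Prop := ∀ x : 𝔤, LinearMap.trace ℝ 𝔤 (LieAlgebra.ad ℝ 𝔤 x) = 0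

end Complex

/-! ### Lefschetz operators -/

section Lefschetz

variable {𝔤 : Type*} [LieRing 𝔤] [LieAlgebra ℝ 𝔤] [Module.Finite ℝ 𝔤]

namespace SymplecticForm

variable (ω : SymplecticForm 𝔤)

theorem extD_pow_mul (j : ℕ) (α : Form 𝔤) :
    extD (ω.form ^ j * α) = ω.form ^ j * extD α := by
  induction j with
  | zero => simp
  | succ j ih =>
    rw [pow_succ', mul_assoc, extD_mul, ω.closed, zero_mul, zero_add,
      involute_of_mem_two ω.mem_two, ih, mul_assoc]

theorem pow_mul_mem (j k : ℕ) {α : Form 𝔤} (hα : α ∈ kForms 𝔤 k) :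
    ω.form ^ j * α ∈ kForms 𝔤 (k + 2 * j) := by
  have h : ω.form ^ j ∈ kForms 𝔤 (2 * j) := by
    rw [kForms, ExteriorAlgebra.exteriorPower, pow_mul]
    exact Submodule.pow_mem_pow _ ω.mem_two j
  rw [kForms, ExteriorAlgebra.exteriorPower, add_comm, pow_add]
  exact Submodule.mul_mem_mul h hα

/-- Multiplication by `ω^j`, from closed `k`-forms to closed `(k + 2j)`-forms. -/
def mulPow (j k : ℕ) : cocycles 𝔤 k →ₗ[ℝ] cocycles 𝔤 (k + 2 * j) :=
  (LinearMap.mulLeft ℝ (ω.form ^ j)).restrict fun α hα => by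
    refine ⟨?_, ω.pow_mul_mem j k hα.2⟩
    have h : extD α = 0 := hα.1
    change extD (ω.form ^ j * α) = 0
    rw [ω.extD_pow_mul, h, mul_zero]

/-- The Lefschetz operator `L_j : H^k(𝔤) → H^{k+2j}(𝔤)`, `[α] ↦ [ω^j ∧ α]`. -/
def lefschetz (j k : ℕ) : Cohomology 𝔤 k →ₗ[ℝ] Cohomology 𝔤 (k + 2 * j) :=
  Submodule.mapQ _ _ (ω.mulPow j k) <| by
    rintro ⟨α, hα⟩ ⟨⟨β, hβ⟩, -⟩
    exact ⟨⟨ω.form ^ j * β, by rw [ω.extD_pow_mul, hβ]; rfl⟩, ω.pow_mul_mem j k hα.2⟩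

/-- The hard-Lefschetz condition: with `dim 𝔤 = 2n`, the operator
`L_j : H^{n-j}(𝔤) → H^{n+j}(𝔤)` is an isomorphism for all `0 ≤ j ≤ n`
(here `k = n - j`, so that `k + 2j = n + j`). -/
def HardLefschetz : Prop :=
  ∀ j k : ℕ, Module.finrank ℝ 𝔤 = 2 * (j + k) → Function.Bijective (ω.lefschetz j k)

/-- The hard-Lefschetz condition fails at degree `k`: with `dim 𝔤 = 2n`, we have `k ≤ n` and
`L_{n-k} : H^k(𝔤) → H^{2n-k}(𝔤)` has nontrivial kernel (here `j = n - k`). -/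
def FailsAtDegree (k : ℕ) : Prop :=
  ∃ j : ℕ, Module.finrank ℝ 𝔤 = 2 * (j + k) ∧ LinearMap.ker (ω.lefschetz j k) ≠ ⊥

end SymplecticForm

end Lefschetz

/-! ### Almost abelian Lie algebras -/

/-- The vector space `ℝ f₁ ⊕ 𝔲` underlying the almost abelian Lie algebra
`𝔤_A = ℝ f₁ ⋉_A 𝔲` with structure map `A`; the pair `(s, u)` stands for `s f₁ + u`. -/
def AlmostAbelian {𝔲 : Type*} [AddCommGroup 𝔲] [Module ℝ 𝔲] (_A : Module.End ℝ 𝔲) : Type _ :=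
  ℝ × 𝔲

namespace AlmostAbelian

variable {𝔲 : Type*} [AddCommGroup 𝔲] [Module ℝ 𝔲] (A : Module.End ℝ 𝔲)

instance : AddCommGroup (AlmostAbelian A) := inferInstanceAs (AddCommGroup (ℝ × 𝔲))

instance : Module ℝ (AlmostAbelian A) := inferInstanceAs (Module ℝ (ℝ × 𝔲))

instance [Module.Finite ℝ 𝔲] : Module.Finite ℝ (AlmostAbelian A) :=
  inferInstanceAs (Module.Finite ℝ (ℝ × 𝔲))

/-- The bracket with `[𝔲, 𝔲] = 0` and `[f₁, u] = A u`. -/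
instance : Bracket (AlmostAbelian A) (AlmostAbelian A) where
  bracket x y := ((0 : ℝ), x.1 • A y.2 - y.1 • A x.2)

theorem bracket_def (x y : AlmostAbelian A) :
    ⁅x, y⁆ = ((0 : ℝ), x.1 • A y.2 - y.1 • A x.2) := rfl

instance : LieRing (AlmostAbelian A) where
  add_lie x y z := by
    refine Prod.ext (add_zero (0 : ℝ)).symm ?_
    change (x.1 + y.1) • A z.2 - z.1 • A (x.2 + y.2) =
      (x.1 • A z.2 - z.1 • A x.2) + (y.1 • A z.2 - z.1 • A y.2)
    rw [map_add]; module
  lie_add x y z := by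
    refine Prod.ext (add_zero (0 : ℝ)).symm ?_
    change x.1 • A (y.2 + z.2) - (y.1 + z.1) • A x.2 =
      (x.1 • A y.2 - y.1 • A x.2) + (x.1 • A z.2 - z.1 • A x.2)
    rw [map_add]; module
  lie_self x := Prod.ext rfl (sub_self _)
  leibniz_lie x y z := by
    refine Prod.ext (add_zero (0 : ℝ)).symm ?_
    change x.1 • A (y.1 • A z.2 - z.1 • A y.2) - (0 : ℝ) • A x.2 =
      ((0 : ℝ) • A z.2 - z.1 • A (x.1 • A y.2 - y.1 • A x.2)) +
        (y.1 • A (x.1 • A z.2 - z.1 • A x.2) - (0 : ℝ) • A y.2)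
    simp only [map_sub, map_smul]; module

instance : LieAlgebra ℝ (AlmostAbelian A) where
  lie_smul t x y := by
    refine Prod.ext (mul_zero t).symm ?_
    change x.1 • A (t • y.2) - (t * y.1) • A x.2 = t • (x.1 • A y.2 - y.1 • A x.2)
    rw [map_smul]; module

/-- The distinguished vector `f₁`. -/
def f₁ : AlmostAbelian A := ((1 : ℝ), (0 : 𝔲))

/-- The inclusion of the abelian ideal `𝔲`. -/
def incl : 𝔲 →ₗ[ℝ] AlmostAbelian A := LinearMap.inr ℝ ℝ 𝔲

theorem f₁_lie_incl (u : 𝔲) : ⁅f₁ A, incl A u⁆ = incl A (A u) := by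
  refine Prod.ext rfl ?_
  change (1 : ℝ) • A u - (0 : ℝ) • A 0 = A u
  simp

theorem incl_lie_incl (u v : 𝔲) : ⁅incl A u, incl A v⁆ = 0 := by
  refine Prod.ext rfl ?_
  change (0 : ℝ) • A v - (0 : ℝ) • A u = 0
  simp

end AlmostAbelian

/-! ### The splitting of `𝔲` defined by a symplectic form -/

section Splitting

open AlmostAbelian

variable {𝔲 : Type*} [AddCommGroup 𝔲] [Module ℝ 𝔲] [Module.Finite ℝ 𝔲] {A : Module.End ℝ 𝔲}

/-- `f₂ ∈ 𝔲` is the vector with `ω(f₁, f₂) = 1` and `ω(f₂, 𝔲) = 0`; so `ω = f¹ ∧ f² + ω₀` with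
`ω₀` a `2`-form on the complement `𝔲₀` of `ℝ f₁ ⊕ ℝ f₂`. -/
structure IsAdapted (ω : SymplecticForm (AlmostAbelian A)) (f₂ : 𝔲) : Prop where
  pairing : evalTwo ω.form (f₁ A) (incl A f₂) = 1
  orthogonal : ∀ u : 𝔲, evalTwo ω.form (incl A f₂) (incl A u) = 0

variable (ω : SymplecticForm (AlmostAbelian A)) (f₂ : 𝔲)

/-- The subspace `𝔲₀` of `𝔲`: the `ω`-orthogonal complement of `{f₁, f₂}`. -/
def uZero : Submodule ℝ 𝔲 where
  carrier := {u | evalTwo ω.form (f₁ A) (incl A u) = 0 ∧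
    evalTwo ω.form (incl A f₂) (incl A u) = 0}
  zero_mem' := by simp [evalTwo, interiorProd]
  add_mem' := by
    rintro u v ⟨hu, hu'⟩ ⟨hv, hv'⟩
    constructor
    · rw [map_add, evalTwo_add_right, hu, hv, add_zero]
    · rw [map_add, evalTwo_add_right, hu', hv', add_zero]
  smul_mem' := by
    rintro c u ⟨hu, hu'⟩
    constructor
    · rw [map_smul, evalTwo_smul_right, hu, mul_zero]
    · rw [map_smul, evalTwo_smul_right, hu', mul_zero]

/-- The coordinate `f²` on `𝔲 = ℝ f₂ ⊕ 𝔲₀`, that is `u ↦ ω(f₁, u)`. -/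
def fTwoCoord : 𝔲 →ₗ[ℝ] ℝ where
  toFun u := evalTwo ω.form (f₁ A) (incl A u)
  map_add' u v := by rw [map_add, evalTwo_add_right]
  map_smul' c u := by rw [map_smul, evalTwo_smul_right]; rfl

/-- The row `v` of the block form `A = [[a, v], [0, A₀]]` with respect to `𝔲 = ℝ f₂ ⊕ 𝔲₀`:
the `f₂`-coordinate of `A x` for `x ∈ 𝔲₀`. -/
def blockV : uZero ω f₂ →ₗ[ℝ] ℝ := (fTwoCoord ω).comp (A.domRestrict (uZero ω f₂))

variable {ω f₂}

/-- The block `A₀` of `A` with respect to `𝔲 = ℝ f₂ ⊕ 𝔲₀`: the `𝔲₀`-component of `A x` for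
`x ∈ 𝔲₀`. -/
def blockAZero (h : IsAdapted ω f₂) : Module.End ℝ (uZero ω f₂) :=
  LinearMap.codRestrict (uZero ω f₂)
    (A.domRestrict (uZero ω f₂) - (blockV ω f₂).smulRight f₂) fun x => by
      have e : (A.domRestrict (uZero ω f₂) - (blockV ω f₂).smulRight f₂) x =
          A x + (-(fTwoCoord ω (A x))) • f₂ := by
        simp [blockV, sub_eq_add_neg]
      rw [e]
      constructor
      · rw [map_add, map_smul, evalTwo_add_right, evalTwo_smul_right, h.pairing]
        change fTwoCoord ω (A x) + _ = 0
        ring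
      · exact h.orthogonal _

/-- For `x ∈ 𝔲₀`, `A x = v(x) f₂ + A₀ x`. -/
theorem block_apply (h : IsAdapted ω f₂) (x : uZero ω f₂) :
    A x = blockV ω f₂ x • f₂ + (blockAZero h x : 𝔲) := by
  simp [blockAZero]

/-- The generalized eigenspace `V₀` of `A₀` for the eigenvalue `0`. -/
def genV (h : IsAdapted ω f₂) : Submodule ℝ (uZero ω f₂) :=
  (blockAZero h).maxGenEigenspace 0

/-- The subspace `W₀ = ℝ f₂ ⊕ V₀` of `𝔲`. -/
def genW (h : IsAdapted ω f₂) : Submodule ℝ 𝔲 :=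
  Submodule.span ℝ {f₂} ⊔ (genV h).map (uZero ω f₂).subtype

/-- The block `M`: the restriction of `A` to `W₀`. -/
def blockM (h : IsAdapted ω f₂) : genW h →ₗ[ℝ] 𝔲 := A.domRestrict (genW h)

end Splitting

end LieForms

end

/-! Two independent facts combine.

Linear algebra: closedness of `ω₀` makes `A` skew for `ω₀` on `𝔲`, so `A f₂` is a multiple of `f₂`,
and unimodularity makes that multiple zero (`IsAdapted.map_eq_zero`). Since `A₀` is nilpotent on
`V₀`, `A` is then nilpotent on `W₀`; if `M ≠ 0`, some `u` satisfies `A u ≠ 0` and `A (A u) = 0`.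
This property of `u` involves only `A`, so it can be used with every symplectic form `ω`.

Lefschetz: put `θ = ω([f₁, u], ·)`. Skewness of `A` for `ω` and `A (A u) = 0` make `[f₁, u]`
orthogonal to all brackets, so `θ` is closed; it is nonzero, and `d` vanishes on scalars, so it is
not exact. But `ω^(n-1) ∧ θ` is `1/n` times the contraction of `ω^n` by `[f₁, u]`. On a unimodular
algebra Lie derivatives kill top forms, so Cartan calculus exhibits that contraction as a coboundary
(`IsUnimodular.interiorProd_lie_top`). Hence `[θ]` is a nonzero class in the kernel of `L_(n-1)` on
`H¹` (`SymplecticForm.failsAtDegree_one`). -/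

noncomputable section

namespace LieForms

/-! ### Interior products and 2-forms -/

section Contraction

variable {𝔤 : Type*} [LieRing 𝔤] [LieAlgebra ℝ 𝔤]

theorem interiorProd_ι_mul (x : 𝔤) (θ : Module.Dual ℝ 𝔤) (α : Form 𝔤) :
    interiorProd x (ExteriorAlgebra.ι ℝ θ * α) =
      θ x • α - ExteriorAlgebra.ι ℝ θ * interiorProd x α :=
  CliffordAlgebra.contractLeft_ι_mul _ _ _

theorem interiorProd_ι (x : 𝔤) (θ : Module.Dual ℝ 𝔤) :
    interiorProd x (ExteriorAlgebra.ι ℝ θ) = algebraMap ℝ _ (θ x) :=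
  CliffordAlgebra.contractLeft_ι _ _ _

theorem interiorProd_algebraMap (x : 𝔤) (r : ℝ) :
    interiorProd x (algebraMap ℝ (Form 𝔤) r) = 0 :=
  CliffordAlgebra.contractLeft_algebraMap _ _ _

theorem interiorProd_comm (x y : 𝔤) (α : Form 𝔤) :
    interiorProd x (interiorProd y α) = -interiorProd y (interiorProd x α) :=
  CliffordAlgebra.contractLeft_comm _ _ _

/-- Induction principle for forms: scalars, sums, and left multiplication by `1`-forms. -/
theorem form_induction {P : Form 𝔤 → Prop} (algebraMap : ∀ r, P (algebraMap ℝ _ r))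
    (add : ∀ a b, P a → P b → P (a + b))
    (ι_mul : ∀ θ a, P a → P (ExteriorAlgebra.ι ℝ θ * a)) (α : Form 𝔤) : P α :=
  CliffordAlgebra.left_induction (Q := (0 : QuadraticForm ℝ (Module.Dual ℝ 𝔤))) algebraMap
    (fun a b => add a b) (fun a θ => ι_mul θ a) α

/-- Induction principle for `2`-forms. -/
theorem two_form_induction {P : Form 𝔤 → Prop}
    (ι_mul_ι : ∀ θ η, P (ExteriorAlgebra.ι ℝ θ * ExteriorAlgebra.ι ℝ η))
    (add : ∀ a b, P a → P b → P (a + b)) {α : Form 𝔤} (hα : α ∈ kForms 𝔤 2) : P α := by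
  rw [kForms, ExteriorAlgebra.exteriorPower, pow_two] at hα
  induction hα using Submodule.mul_induction_on' with
  | mem_mul_mem a ha b hb =>
    obtain ⟨θ, rfl⟩ := ha
    obtain ⟨η, rfl⟩ := hb
    exact ι_mul_ι θ η
  | add a _ b _ ha hb => exact add a b ha hb

theorem involute_ι_mul (θ : Module.Dual ℝ 𝔤) (α : Form 𝔤) :
    CliffordAlgebra.involute (ExteriorAlgebra.ι ℝ θ * α) =
      -(ExteriorAlgebra.ι ℝ θ * CliffordAlgebra.involute α) := by
  rw [map_mul, ExteriorAlgebra.ι, CliffordAlgebra.involute_ι, neg_mul]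

/-- The interior product is an antiderivation. -/
theorem interiorProd_mul (x : 𝔤) (α β : Form 𝔤) :
    interiorProd x (α * β) =
      interiorProd x α * β + CliffordAlgebra.involute α * interiorProd x β := by
  induction α using form_induction with
  | algebraMap r =>
    rw [interiorProd_algebraMap, ← Algebra.smul_def, map_smul, Algebra.smul_def, zero_mul,
      zero_add]
    congr 1
    exact (AlgHom.commutes _ r).symm
  | add a b ha hb =>
    rw [add_mul, map_add, ha, hb, map_add, map_add, add_mul, add_mul]
    abel
  | ι_mul θ a ha =>
    rw [involute_ι_mul, mul_assoc, interiorProd_ι_mul, interiorProd_ι_mul, ha, sub_mul, mul_add,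
      smul_mul_assoc, neg_mul, mul_assoc, mul_assoc]
    abel

theorem interiorProd_mul_of_mem_two (x : 𝔤) {α : Form 𝔤} (hα : α ∈ kForms 𝔤 2) (β : Form 𝔤) :
    interiorProd x (α * β) = interiorProd x α * β + α * interiorProd x β := by
  rw [interiorProd_mul, involute_of_mem_two hα]

theorem evalTwo_add_left (α : Form 𝔤) (x y z : 𝔤) :
    evalTwo α (x + y) z = evalTwo α x z + evalTwo α y z := by
  simp [evalTwo, interiorProd]

theorem evalTwo_smul_left (α : Form 𝔤) (c : ℝ) (x y : 𝔤) :
    evalTwo α (c • x) y = c * evalTwo α x y := by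
  simp [evalTwo, interiorProd]

theorem evalTwo_swap (α : Form 𝔤) (x y : 𝔤) : evalTwo α x y = -evalTwo α y x := by
  rw [evalTwo, interiorProd_comm, map_neg, evalTwo]

/-- The bilinear form `(x, y) ↦ α(x, y)`. -/
def evalTwoBilin (α : Form 𝔤) : 𝔤 →ₗ[ℝ] Module.Dual ℝ 𝔤 :=
  LinearMap.mk₂ ℝ (evalTwo α) (evalTwo_add_left α) (evalTwo_smul_left α)
    (evalTwo_add_right α) (evalTwo_smul_right α)

@[simp]
theorem evalTwoBilin_apply (α : Form 𝔤) (x y : 𝔤) : evalTwoBilin α x y = evalTwo α x y := rfl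

theorem interiorProd_of_mem_two (x : 𝔤) {α : Form 𝔤} (hα : α ∈ kForms 𝔤 2) :
    interiorProd x α = ExteriorAlgebra.ι ℝ (evalTwoBilin α x) := by
  refine two_form_induction (P := fun α => interiorProd x α = ExteriorAlgebra.ι ℝ (evalTwoBilin α x))
    (fun θ η => ?_) (fun a b ha hb => ?_) hα
  ·
    have h : evalTwoBilin (ExteriorAlgebra.ι ℝ θ * ExteriorAlgebra.ι ℝ η) x =
        θ x • η - η x • θ := by
      ext y
      simp [evalTwo_ι_mul_ι]
      ring
    rw [h, interiorProd_ι_mul, interiorProd_ι, map_sub, map_smul, map_smul, Algebra.smul_def,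
      Algebra.smul_def, Algebra.commutes, Algebra.commutes (η x)]
  · have h : evalTwoBilin (a + b) x = evalTwoBilin a x + evalTwoBilin b x := by
      ext y
      simp [evalTwo]
    rw [h, map_add, map_add, ha, hb]

theorem interiorProd_interiorProd_of_mem_two (x y : 𝔤) {α : Form 𝔤} (hα : α ∈ kForms 𝔤 2) :
    interiorProd y (interiorProd x α) = algebraMap ℝ _ (evalTwo α x y) := by
  rw [interiorProd_of_mem_two x hα, interiorProd_ι, evalTwoBilin_apply]

theorem mul_ι_of_mem_two {α : Form 𝔤} (hα : α ∈ kForms 𝔤 2) (c : Module.Dual ℝ 𝔤) :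
    α * ExteriorAlgebra.ι ℝ c = ExteriorAlgebra.ι ℝ c * α := by
  refine two_form_induction
    (P := fun α => α * ExteriorAlgebra.ι ℝ c = ExteriorAlgebra.ι ℝ c * α)
    (fun a b => ?_) (fun a b ha hb => ?_) hα
  · rw [mul_assoc, eq_neg_of_add_eq_zero_left (ExteriorAlgebra.ι_add_mul_swap b c), mul_neg,
      ← mul_assoc, eq_neg_of_add_eq_zero_left (ExteriorAlgebra.ι_add_mul_swap a c), neg_mul,
      neg_neg, mul_assoc]
  · rw [add_mul, mul_add, ha, hb]

/-- A 2-form commutes with 1-forms, so the Leibniz rule gives the usual power rule. It turns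
contractions of `ω^n` into Lefschetz images of 1-forms. -/
theorem interiorProd_pow_of_mem_two (x : 𝔤) {α : Form 𝔤} (hα : α ∈ kForms 𝔤 2) (j : ℕ) :
    interiorProd x (α ^ (j + 1)) = ((j : ℝ) + 1) • (α ^ j * interiorProd x α) := by
  induction j with
  | zero => simp
  | succ j ih =>
    have hc : Commute α (interiorProd x α) := by
      rw [interiorProd_of_mem_two x hα]
      exact mul_ι_of_mem_two hα _
    rw [pow_succ', interiorProd_mul_of_mem_two x hα, ih, ← (hc.pow_left (j + 1)).eq,
      mul_smul_comm, ← mul_assoc, ← pow_succ', Nat.cast_succ, add_smul ((j : ℝ) + 1), one_smul,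
      add_comm]

end Contraction

/-! ### Cartan calculus and exact forms of low degree -/

section LieDerivative

variable {𝔤 : Type*} [LieRing 𝔤] [LieAlgebra ℝ 𝔤] [Module.Finite ℝ 𝔤]

/-- The Lie derivative `L_x = d ι_x + ι_x d`. -/
def lieDeriv (x : 𝔤) : Form 𝔤 →ₗ[ℝ] Form 𝔤 :=
  extD ∘ₗ interiorProd x + interiorProd x ∘ₗ extD

theorem lieDeriv_apply (x : 𝔤) (α : Form 𝔤) :
    lieDeriv x α = extD (interiorProd x α) + interiorProd x (extD α) := rfl

theorem lieDeriv_algebraMap (x : 𝔤) (r : ℝ) : lieDeriv x (algebraMap ℝ _ r) = 0 := by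
  rw [lieDeriv_apply, interiorProd_algebraMap, extD_algebraMap, map_zero, map_zero, add_zero]

theorem lieDeriv_one (x : 𝔤) : lieDeriv x (1 : Form 𝔤) = 0 := by
  simpa using lieDeriv_algebraMap x 1

theorem interiorProd_dOne (x : 𝔤) (θ : Module.Dual ℝ 𝔤) :
    interiorProd x (dOne θ) =
      ExteriorAlgebra.ι ℝ (-(LieAlgebra.ad ℝ 𝔤 x).dualMap θ) := by
  rw [interiorProd_of_mem_two x (dOne_mem θ)]
  congr 1
  ext y
  simp [evalTwo_dOne]

/-- The cross terms of the two antiderivations cancel, so the Lie derivative is a derivation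
extending the coadjoint action. -/
theorem lieDeriv_ι_mul (x : 𝔤) (θ : Module.Dual ℝ 𝔤) (α : Form 𝔤) :
    lieDeriv x (ExteriorAlgebra.ι ℝ θ * α) =
      ExteriorAlgebra.ι ℝ (-(LieAlgebra.ad ℝ 𝔤 x).dualMap θ) * α +
        ExteriorAlgebra.ι ℝ θ * lieDeriv x α := by
  rw [lieDeriv_apply, lieDeriv_apply, interiorProd_ι_mul, extD_ι_mul, map_sub, map_sub, map_smul,
    extD_ι_mul, interiorProd_ι_mul, interiorProd_mul_of_mem_two x (dOne_mem θ), interiorProd_dOne,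
    mul_add]
  abel

/-- Cartan's identity `[L_x, ι_y] = ι_[x,y]`: in the induction, the bracket term comes from the
coadjoint action on the leading 1-form. -/
theorem lieDeriv_interiorProd (x y : 𝔤) (α : Form 𝔤) :
    lieDeriv x (interiorProd y α) =
      interiorProd y (lieDeriv x α) + interiorProd ⁅x, y⁆ α := by
  induction α using form_induction with
  | algebraMap r =>
    simp only [interiorProd_algebraMap, lieDeriv_algebraMap, map_zero, add_zero]
  | add a b ha hb =>
    simp only [map_add, ha, hb]
    abel
  | ι_mul θ a ha =>
    rw [interiorProd_ι_mul, map_sub, map_smul, lieDeriv_ι_mul, lieDeriv_ι_mul, ha, map_add,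
      interiorProd_ι_mul, interiorProd_ι_mul, interiorProd_ι_mul, mul_add]
    simp only [LinearMap.neg_apply, LinearMap.dualMap_apply, LieAlgebra.ad_apply, neg_smul]
    abel

/-- For a closed `2`-form, `0 = dα(x, y, z)` in terms of the Lie derivative along `x`. -/
theorem evalTwo_closed {α : Form 𝔤} (hα : α ∈ kForms 𝔤 2) (hd : extD α = 0) (x y z : 𝔤) :
    evalTwo α ⁅x, y⁆ z + evalTwo α y ⁅x, z⁆ = evalTwo α x ⁅y, z⁆ := by
  apply (ExteriorAlgebra.algebraMap_leftInverse (R := ℝ) (Module.Dual ℝ 𝔤)).injective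
  have h : lieDeriv x α = dOne (evalTwoBilin α x) := by
    rw [lieDeriv_apply, hd, map_zero, add_zero, interiorProd_of_mem_two x hα, extD_ι]
  -- The scalar `α(y, z)` has zero Lie derivative; commuting `L_x` past both contractions yields the
  -- identity.
  have h1 : lieDeriv x (interiorProd z (interiorProd y α)) = 0 := by
    rw [interiorProd_interiorProd_of_mem_two y z hα, lieDeriv_algebraMap]
  rw [lieDeriv_interiorProd, lieDeriv_interiorProd, h, map_add,
    interiorProd_interiorProd_of_mem_two _ _ hα, interiorProd_interiorProd_of_mem_two _ _ hα,
    interiorProd_interiorProd_of_mem_two _ _ (dOne_mem _), evalTwo_dOne, evalTwoBilin_apply,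
    add_assoc, map_neg, neg_add_eq_zero] at h1
  rw [map_add, ← h1]

/-- The degree zero part of an exact form vanishes. -/
theorem algebraMapInv_extD (α : Form 𝔤) : ExteriorAlgebra.algebraMapInv (extD α) = 0 := by
  have hι : ∀ θ : Module.Dual ℝ 𝔤,
      ExteriorAlgebra.algebraMapInv (ExteriorAlgebra.ι ℝ θ) = (0 : ℝ) := fun θ => by
    simp [ExteriorAlgebra.algebraMapInv]
  have h2 : ∀ θ : Module.Dual ℝ 𝔤, ExteriorAlgebra.algebraMapInv (dOne θ) = (0 : ℝ) := by
    intro θ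
    exact two_form_induction (P := fun β => ExteriorAlgebra.algebraMapInv β = (0 : ℝ))
      (fun a b => by rw [map_mul, hι, zero_mul])
      (fun a b ha hb => by rw [map_add, ha, hb, add_zero]) (dOne_mem θ)
  induction α using form_induction with
  | algebraMap r => rw [extD_algebraMap, map_zero]
  | add a b ha hb => rw [map_add, map_add, ha, hb, add_zero]
  | ι_mul θ a ha => rw [extD_ι_mul, map_sub, map_mul, map_mul, h2, hι, zero_mul, zero_mul, sub_zero]

/-- The degree one part of an exact form vanishes. -/
theorem algebraMapInv_interiorProd_extD (x : 𝔤) (α : Form 𝔤) :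
    ExteriorAlgebra.algebraMapInv (interiorProd x (extD α)) = 0 := by
  have h := algebraMapInv_extD (interiorProd x α)
  -- Since `ι_x d = L_x - d ι_x`, it remains to see that `L_x` produces no scalar part.
  have h' : ExteriorAlgebra.algebraMapInv (lieDeriv x α) = (0 : ℝ) := by
    have hι : ∀ θ : Module.Dual ℝ 𝔤,
        ExteriorAlgebra.algebraMapInv (ExteriorAlgebra.ι ℝ θ) = (0 : ℝ) := fun θ => by
      simp [ExteriorAlgebra.algebraMapInv]
    induction α using form_induction with
    | algebraMap r => rw [lieDeriv_algebraMap, map_zero]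
    | add a b ha hb =>
      rw [map_add, map_add, ha (algebraMapInv_extD _), hb (algebraMapInv_extD _), add_zero]
    | ι_mul θ a ha => rw [lieDeriv_ι_mul, map_add, map_mul, map_mul, hι, hι, zero_mul, zero_mul,
        add_zero]
  rwa [lieDeriv_apply, map_add, h, zero_add] at h'

theorem ι_mem_range_extD_iff (θ : Module.Dual ℝ 𝔤) :
    ExteriorAlgebra.ι ℝ θ ∈ LinearMap.range (extD (𝔤 := 𝔤)) ↔ θ = 0 := by
  refine ⟨?_, fun h => by simp [h]⟩
  rintro ⟨β, hβ⟩
  ext x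
  have h := algebraMapInv_interiorProd_extD x β
  rwa [hβ, interiorProd_ι, ExteriorAlgebra.algebraMap_leftInverse] at h

end LieDerivative

/-! ### Derivations on top forms and unimodularity -/

section TopForms

variable {V : Type*} [AddCommGroup V] [Module ℝ V]

/-- A derivation of the exterior algebra that extends an endomorphism `T`, on a decomposable
form. -/
theorem derivation_ιMulti {L : ExteriorAlgebra ℝ V →ₗ[ℝ] ExteriorAlgebra ℝ V} {T : Module.End ℝ V}
    (h1 : L 1 = 0)
    (hL : ∀ θ α, L (ExteriorAlgebra.ι ℝ θ * α) =
      ExteriorAlgebra.ι ℝ (T θ) * α + ExteriorAlgebra.ι ℝ θ * L α) (n : ℕ) (v : Fin n → V) :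
    L (ExteriorAlgebra.ιMulti ℝ n v) =
      ∑ i, ExteriorAlgebra.ιMulti ℝ n (Function.update v i (T (v i))) := by
  induction n with
  | zero => simp [h1]
  | succ n ih =>
    rw [ExteriorAlgebra.ιMulti_succ_apply, hL, ih, Fin.sum_univ_succ, Finset.mul_sum]
    congr 1
    · rw [ExteriorAlgebra.ιMulti_succ_apply, Function.update_self]
      congr 2
    · refine Finset.sum_congr rfl fun i _ => ?_
      rw [ExteriorAlgebra.ιMulti_succ_apply, Function.update_of_ne (Fin.succ_ne_zero i).symm]
      congr 2
      ext k
      by_cases hk : k = i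
      · subst hk
        simp [Matrix.vecTail]
      · simp [Matrix.vecTail, hk]

theorem derivation_ιMulti_basis {L : ExteriorAlgebra ℝ V →ₗ[ℝ] ExteriorAlgebra ℝ V}
    {T : Module.End ℝ V} (h1 : L 1 = 0)
    (hL : ∀ θ α, L (ExteriorAlgebra.ι ℝ θ * α) =
      ExteriorAlgebra.ι ℝ (T θ) * α + ExteriorAlgebra.ι ℝ θ * L α) {n : ℕ}
    (b : Module.Basis (Fin n) ℝ V) :
    L (ExteriorAlgebra.ιMulti ℝ n b) =
      LinearMap.trace ℝ V T • ExteriorAlgebra.ιMulti ℝ n b := by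
  rw [derivation_ιMulti h1 hL, LinearMap.trace_eq_matrix_trace ℝ b, Matrix.trace, Finset.sum_smul]
  refine Finset.sum_congr rfl fun i _ => ?_
  conv_lhs => rw [← b.sum_repr (T (b i))]
  -- Replacing `b i` by another basis vector repeats a factor, so only the diagonal coefficients
  -- survive.
  rw [AlternatingMap.map_update_sum, Finset.sum_eq_single i]
  · rw [AlternatingMap.map_update_smul, Function.update_eq_self, Matrix.diag_apply,
      LinearMap.toMatrix_apply]
  · intro j _ hj
    rw [AlternatingMap.map_update_smul, AlternatingMap.map_update_self _ _ hj.symm, smul_zero]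
  · simp

/-- A derivation of the exterior algebra that extends `T` acts on top forms by `tr T`. -/
theorem derivation_top {L : ExteriorAlgebra ℝ V →ₗ[ℝ] ExteriorAlgebra ℝ V}
    {T : Module.End ℝ V} (h1 : L 1 = 0)
    (hL : ∀ θ α, L (ExteriorAlgebra.ι ℝ θ * α) =
      ExteriorAlgebra.ι ℝ (T θ) * α + ExteriorAlgebra.ι ℝ θ * L α) [Module.Finite ℝ V]
    {α : ExteriorAlgebra ℝ V} (hα : α ∈ ⋀[ℝ]^(Module.finrank ℝ V) V) :
    L α = LinearMap.trace ℝ V T • α := by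
  let b := Module.finBasis ℝ V
  rw [← exteriorPower.ιMulti_span_fixedDegree_of_span_eq_top ℝ _ V b.span_eq] at hα
  induction hα using Submodule.span_induction with
  | mem x hx =>
    obtain ⟨v, hv, rfl⟩ := hx
    -- An injective family of `n` vectors of a basis with `n` elements is a reindexing of it; any
    -- other family has zero wedge product.
    by_cases hinj : Function.Injective v
    · choose σ hσ using fun i => hv ⟨i, rfl⟩
      have hσi : Function.Injective σ := fun i j hij => hinj (by rw [← hσ, ← hσ, hij])
      have : v = b.reindex (Equiv.ofBijective σ (Finite.injective_iff_bijective.1 hσi)).symm := by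
        ext i
        simp [hσ]
      rw [this]
      exact derivation_ιMulti_basis h1 hL _
    · rw [AlternatingMap.map_eq_zero_of_not_injective _ _ hinj, map_zero, smul_zero]
  | zero => simp
  | add a b _ _ ha hb => rw [map_add, ha, hb, smul_add]
  | smul c a _ ha => rw [map_smul, ha, smul_comm]

variable {𝔤 : Type*} [LieRing 𝔤] [LieAlgebra ℝ 𝔤] [Module.Finite ℝ 𝔤]

/-- The Lie derivative acts on top forms by the trace of the coadjoint action, which is `-tr(ad x)`.
-/
theorem IsUnimodular.lieDeriv_top (h : IsUnimodular 𝔤) (x : 𝔤) {α : Form 𝔤}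
    (hα : α ∈ kForms 𝔤 (Module.finrank ℝ 𝔤)) : lieDeriv x α = 0 := by
  rw [← Subspace.dual_finrank_eq] at hα
  rw [derivation_top (T := -(LieAlgebra.ad ℝ 𝔤 x).dualMap) (lieDeriv_one x)
    (fun θ α => lieDeriv_ι_mul x θ α) hα]
  have : LinearMap.trace ℝ _ (-(LieAlgebra.ad ℝ 𝔤 x).dualMap) = 0 := by
    refine (map_neg (LinearMap.trace ℝ (Module.Dual ℝ 𝔤)) _).trans ?_
    exact neg_eq_zero.2 ((LinearMap.trace_transpose' _).trans (h x))
  rw [this, zero_smul]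

/-- On a unimodular Lie algebra, the contraction of a closed top form by a bracket is exact. -/
theorem IsUnimodular.interiorProd_lie_top (h : IsUnimodular 𝔤) (x y : 𝔤) {α : Form 𝔤}
    (hα : α ∈ kForms 𝔤 (Module.finrank ℝ 𝔤)) (hd : extD α = 0) :
    interiorProd ⁅x, y⁆ α = extD (interiorProd x (interiorProd y α)) := by
  have h1 := lieDeriv_interiorProd x y α
  have h2 := h.lieDeriv_top y hα
  -- As `α` is closed, `L_y α = 0` says that `ι_y α` is closed as well, so `L_x (ι_y α)` reduces to
  -- `d ι_x ι_y α`.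
  rw [lieDeriv_apply, hd, map_zero, add_zero] at h2
  rw [h.lieDeriv_top x hα, map_zero, zero_add, lieDeriv_apply, h2, map_zero, add_zero] at h1
  exact h1.symm

end TopForms

/-! ### Symplectic duality and the failure criterion at degree 1 -/

section Symplectic

variable {𝔤 : Type*} [LieRing 𝔤] [LieAlgebra ℝ 𝔤] [Module.Finite ℝ 𝔤] (ω : SymplecticForm 𝔤)

/-- The isomorphism `𝔤 ≃ 𝔤*` defined by a symplectic form. -/
def SymplecticForm.toDual : 𝔤 ≃ₗ[ℝ] Module.Dual ℝ 𝔤 :=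
  LinearEquiv.ofInjectiveOfFinrankEq (evalTwoBilin ω.form)
    ((injective_iff_map_eq_zero _).2 fun x hx => ω.nondegenerate x fun y => congr($hx y))
    (Subspace.dual_finrank_eq (K := ℝ)).symm

theorem SymplecticForm.toDual_apply (x y : 𝔤) : ω.toDual x y = evalTwo ω.form x y := rfl

/-- An endomorphism that is skew with respect to a symplectic form has trace zero. -/
theorem SymplecticForm.trace_eq_zero_of_skew (T : Module.End ℝ 𝔤)
    (hT : ∀ x y, evalTwo ω.form (T x) y + evalTwo ω.form x (T y) = 0) :
    LinearMap.trace ℝ 𝔤 T = 0 := by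
  -- Skewness says that `ω` conjugates `T` to minus its transpose, whence `tr T = -tr T`.
  have h : ω.toDual.conj T = (-1 : ℝ) • T.dualMap := by
    ext θ y
    obtain ⟨x, rfl⟩ := ω.toDual.surjective θ
    simp only [LinearEquiv.conj_apply, LinearMap.comp_apply, LinearEquiv.coe_coe,
      LinearEquiv.symm_apply_apply, LinearMap.smul_apply, LinearMap.dualMap_apply,
      SymplecticForm.toDual_apply, smul_eq_mul]
    linarith [hT x y]
  have h1 := LinearMap.trace_conj' T ω.toDual
  have h2 : LinearMap.trace ℝ _ T.dualMap = LinearMap.trace ℝ _ T := LinearMap.trace_transpose' T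
  rw [h, map_smul, h2, smul_eq_mul] at h1
  linarith

/-- The Gram matrix is invertible and skew, which is impossible in odd size. -/
theorem SymplecticForm.even_finrank (ω : SymplecticForm 𝔤) : Even (Module.finrank ℝ 𝔤) := by
  let b := Module.finBasis ℝ 𝔤
  let N := LinearMap.toMatrix b b.dualBasis (ω.toDual : 𝔤 →ₗ[ℝ] Module.Dual ℝ 𝔤)
  have hN : N.transpose = -N := by
    ext i j
    simp only [N, Matrix.transpose_apply, Matrix.neg_apply, LinearMap.toMatrix_apply,
      Module.Basis.dualBasis_repr, LinearEquiv.coe_coe, SymplecticForm.toDual_apply]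
    exact evalTwo_swap _ _ _
  have hdet : N.det ≠ 0 := (LinearEquiv.isUnit_det ω.toDual b b.dualBasis).ne_zero
  by_contra hodd
  have h := congr_arg Matrix.det hN
  rw [Matrix.det_transpose, Matrix.det_neg, Fintype.card_fin,
    (Nat.not_even_iff_odd.1 hodd).neg_one_pow] at h
  exact hdet (by linarith)

/-- If a nonzero bracket `[x, y]` is `ω`-orthogonal to `[𝔤, 𝔤]`, then the class of `ι_[x, y] ω` is
in the kernel of the Lefschetz operator on `H¹`. -/
theorem SymplecticForm.failsAtDegree_one (h : IsUnimodular 𝔤) {x y : 𝔤} (hne : ⁅x, y⁆ ≠ 0)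
    (horth : ∀ a b : 𝔤, evalTwo ω.form ⁅x, y⁆ ⁅a, b⁆ = 0) : ω.FailsAtDegree 1 := by
  obtain ⟨n, hn⟩ := even_iff_exists_two_mul.1 ω.even_finrank
  have : Nontrivial 𝔤 := ⟨_, _, hne⟩
  have hpos := Module.finrank_pos (R := ℝ) (M := 𝔤)
  obtain ⟨j, rfl⟩ : ∃ j, n = j + 1 := ⟨n - 1, by omega⟩
  refine ⟨j, hn, fun hker => ?_⟩
  set θ := evalTwoBilin ω.form ⁅x, y⁆ with hθ
  have hθ0 : θ ≠ 0 := fun h0 => hne (ω.nondegenerate _ fun z => congr($h0 z))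
  -- The coefficients of `dθ` are multiples of the values of `ω` on `[x, y]` and a bracket of basis
  -- vectors.
  have hcl : dOne θ = 0 := by
    simp [dOne, hθ, horth]
  have hmem : ExteriorAlgebra.ι ℝ θ ∈ cocycles 𝔤 1 :=
    ⟨(extD_ι θ).trans hcl, by simp [kForms, ExteriorAlgebra.exteriorPower]⟩
  have hclass : Submodule.Quotient.mk (p := (coboundaries 𝔤 1).submoduleOf (cocycles 𝔤 1))
      ⟨_, hmem⟩ ∈ LinearMap.ker (ω.lefschetz j 1) := by
    rw [LinearMap.mem_ker, SymplecticForm.lefschetz]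
    refine (Submodule.mapQ_apply _ _ _ _).trans ((Submodule.Quotient.mk_eq_zero _).2 ?_)
    refine ⟨?_, ω.pow_mul_mem j 1 hmem.2⟩
    change ω.form ^ j * ExteriorAlgebra.ι ℝ θ ∈ LinearMap.range extD
    have htop : ω.form ^ (j + 1) ∈ kForms 𝔤 (Module.finrank ℝ 𝔤) := by
      rw [hn, kForms, ExteriorAlgebra.exteriorPower, pow_mul]
      exact Submodule.pow_mem_pow _ ω.mem_two _
    have hd : extD (ω.form ^ (j + 1)) = 0 := by
      have h1 := ω.extD_pow_mul (j + 1) (algebraMap ℝ _ 1)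
      rwa [extD_algebraMap, mul_zero, map_one, mul_one] at h1
    -- By the power rule the contraction of `ω^(j+1)` by `[x, y]` is `(j + 1) ω^j ∧ θ`; dividing by
    -- `j + 1` gives the primitive.
    have hex := h.interiorProd_lie_top x y htop hd
    rw [interiorProd_pow_of_mem_two _ ω.mem_two, interiorProd_of_mem_two _ ω.mem_two] at hex
    have hj : (j : ℝ) + 1 ≠ 0 := by positivity
    rw [← inv_smul_smul₀ hj (ω.form ^ j * _), hex]
    exact Submodule.smul_mem _ _ ⟨_, rfl⟩
  rw [hker, Submodule.mem_bot, Submodule.Quotient.mk_eq_zero] at hclass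
  exact hθ0 ((ι_mem_range_extD_iff θ).1 hclass.1)

theorem SymplecticForm.FailsAtDegree.not_hardLefschetz {ω : SymplecticForm 𝔤} {k : ℕ}
    (h : ω.FailsAtDegree k) : ¬ ω.HardLefschetz := by
  obtain ⟨j, hj, hker⟩ := h
  exact fun hL => hker (LinearMap.ker_eq_bot.2 (hL j k hj).1)

end Symplectic

/-! ### Symplectic forms on almost abelian algebras -/

namespace AlmostAbelian

variable {𝔲 : Type*} [AddCommGroup 𝔲] [Module ℝ 𝔲] (A : Module.End ℝ 𝔲)

theorem eq_smul_f₁_add_incl (x : AlmostAbelian A) : x = x.1 • f₁ A + incl A x.2 := by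
  refine Prod.ext ?_ ?_
  · change x.1 = x.1 * 1 + 0
    ring
  · change x.2 = x.1 • 0 + x.2
    simp

theorem bracket_eq_incl (x y : AlmostAbelian A) :
    ⁅x, y⁆ = incl A (A (x.1 • y.2 - y.1 • x.2)) := by
  rw [bracket_def, map_sub, map_smul, map_smul]
  rfl

theorem incl_injective : Function.Injective (incl A) := LinearMap.inr_injective

/-- The linear form on `𝔤_A` that vanishes on `𝔲` and takes the value `1` on `f₁`. -/
def fOneCoord : AlmostAbelian A →ₗ[ℝ] ℝ := LinearMap.fst ℝ ℝ 𝔲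

variable [Module.Finite ℝ 𝔲] {A}

/-- This is `dω(f₁, u, w) = 0`; the third term drops out because `𝔲` is abelian. -/
theorem evalTwo_map_add (ω : SymplecticForm (AlmostAbelian A)) (u w : 𝔲) :
    evalTwo ω.form (incl A (A u)) (incl A w) + evalTwo ω.form (incl A u) (incl A (A w)) = 0 := by
  have h := evalTwo_closed ω.mem_two ω.closed (f₁ A) (incl A u) (incl A w)
  rw [incl_lie_incl, f₁_lie_incl, f₁_lie_incl] at h
  rw [h, ← evalTwoBilin_apply, map_zero]

/-- Every bracket lies in the image of `A`, and skewness moves `A` across `ω` onto `A u`, where it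
gives zero. -/
theorem failsAtDegree_one (hA : IsUnimodular (AlmostAbelian A))
    (ω : SymplecticForm (AlmostAbelian A)) {u : 𝔲} (hu : A u ≠ 0) (hu' : A (A u) = 0) :
    ω.FailsAtDegree 1 := by
  refine ω.failsAtDegree_one hA (x := f₁ A) (y := incl A u) ?_ fun a b => ?_
  · rw [f₁_lie_incl]
    exact fun h => hu (incl_injective A (h.trans (map_zero _).symm))
  · have h := evalTwo_map_add ω (A u) (a.1 • b.2 - b.1 • a.2)
    rw [hu', map_zero, ← evalTwoBilin_apply, map_zero, LinearMap.zero_apply, zero_add] at h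
    rw [f₁_lie_incl, bracket_eq_incl, h]

end AlmostAbelian

/-! ### The block form of `A` and nilpotency on `W₀` -/

section Splitting

open AlmostAbelian

variable {𝔲 : Type*} [AddCommGroup 𝔲] [Module ℝ 𝔲] [Module.Finite ℝ 𝔲] {A : Module.End ℝ 𝔲}
  {ω : SymplecticForm (AlmostAbelian A)} {f₂ : 𝔲}

/-- By skewness `A f₂` is orthogonal to `𝔲`, like `f₂`; subtracting the right multiple of `f₂` also
makes it orthogonal to `f₁`, and non-degeneracy applies. -/
theorem IsAdapted.map_eq_smul (h : IsAdapted ω f₂) : A f₂ = fTwoCoord ω (A f₂) • f₂ := by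
  apply incl_injective A
  rw [← sub_eq_zero]
  apply ω.nondegenerate
  have hu : ∀ u : 𝔲, evalTwo ω.form (incl A (A f₂)) (incl A u) = 0 := fun u => by
    have := evalTwo_map_add ω f₂ u
    rwa [h.orthogonal, add_zero] at this
  intro y
  have hp := h.pairing
  rw [evalTwo_swap] at hp
  have hf : fTwoCoord ω (A f₂) = -evalTwo ω.form (incl A (A f₂)) (f₁ A) := evalTwo_swap _ _ _
  rw [eq_smul_f₁_add_incl A y, evalTwo_add_right, evalTwo_smul_right, map_smul,
    ← evalTwoBilin_apply, ← evalTwoBilin_apply]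
  simp only [map_sub, map_smul, LinearMap.sub_apply, LinearMap.smul_apply, evalTwoBilin_apply, hu,
    h.orthogonal, hf, smul_eq_mul]
  linear_combination (-y.1 * evalTwo ω.form (incl A (A f₂)) (f₁ A)) * hp

/-- If `𝔤_A` is unimodular, then `f₂` is central. -/
theorem IsAdapted.map_eq_zero (h : IsAdapted ω f₂) (hA : IsUnimodular (AlmostAbelian A)) :
    A f₂ = 0 := by
  -- `p` makes `ad f₁ + f¹ ⊗ p` skew with respect to `ω`.
  obtain ⟨p, hp⟩ := ω.toDual.surjective
    (-((evalTwoBilin ω.form (f₁ A)).comp (LieAlgebra.ad ℝ (AlmostAbelian A) (f₁ A))))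
  have hp' : ∀ u, evalTwo ω.form p (incl A u) = -evalTwo ω.form (f₁ A) (incl A (A u)) := by
    intro u
    rw [← ω.toDual_apply, hp, ← f₁_lie_incl]
    rfl
  let T : Module.End ℝ (AlmostAbelian A) :=
    LieAlgebra.ad ℝ (AlmostAbelian A) (f₁ A) + (fOneCoord A).smulRight p
  have hT : ∀ x, T x = incl A (A x.2) + x.1 • p := fun x => by
    change ⁅f₁ A, x⁆ + x.1 • p = _
    congr 1
    conv_lhs => rw [eq_smul_f₁_add_incl A x]
    rw [lie_add, lie_smul, lie_self, smul_zero, zero_add, f₁_lie_incl]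
  have htr : LinearMap.trace ℝ _ T = 0 := by
    apply ω.trace_eq_zero_of_skew
    intro x y
    rw [hT, hT]
    have key : ∀ (s t : ℝ) (u w : 𝔲),
        evalTwo ω.form (incl A (A u) + s • p) (t • f₁ A + incl A w) +
          evalTwo ω.form (s • f₁ A + incl A u) (incl A (A w) + t • p) = 0 := by
      intro s t u w
      simp only [evalTwo_add_left, evalTwo_add_right, evalTwo_smul_left, evalTwo_smul_right, hp']
      rw [evalTwo_swap _ (incl A u) p, hp', evalTwo_swap _ (incl A (A u)) (f₁ A),
        evalTwo_swap _ p (f₁ A)]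
      linear_combination evalTwo_map_add ω u w
    have hxy := key x.1 y.1 x.2 y.2
    rwa [← eq_smul_f₁_add_incl, ← eq_smul_f₁_add_incl] at hxy
  -- `T` is skew, hence traceless, and `ad f₁` is traceless by unimodularity; the remaining rank-one
  -- term has trace `f¹(p)`.
  have hp1 : fOneCoord A p = 0 := by
    have h1 : LinearMap.trace ℝ _ T = LinearMap.trace ℝ _ (LieAlgebra.ad ℝ _ (f₁ A)) +
        LinearMap.trace ℝ _ ((fOneCoord A).smulRight p) := map_add _ _ _
    rw [htr, hA, zero_add, LinearMap.trace_smulRight] at h1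
    exact h1.symm
  -- Pairing `p` with `f₂` gives `f¹(p)` on one side and `-ω(f₁, A f₂)` on the other.
  have hf : fTwoCoord ω (A f₂) = 0 := by
    have h1 := hp' f₂
    rw [eq_smul_f₁_add_incl A p, evalTwo_add_left, evalTwo_smul_left, h.pairing,
      evalTwo_swap _ (incl A p.2), h.orthogonal] at h1
    have h2 : p.1 = 0 := hp1
    change evalTwo ω.form (f₁ A) (incl A (A f₂)) = 0
    linarith
  rw [h.map_eq_smul, hf, zero_smul]

theorem exists_pow_apply_eq_smul_add (h : IsAdapted ω f₂) (h0 : A f₂ = 0) (k : ℕ)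
    (x : uZero ω f₂) : ∃ c : ℝ, (A ^ k) x = c • f₂ + ((blockAZero h ^ k) x : uZero ω f₂) := by
  induction k with
  | zero => exact ⟨0, by simp⟩
  | succ k ih =>
    obtain ⟨c, hc⟩ := ih
    -- The previous `f₂`-component is killed by `A`, so only the contribution of `v` at the last
    -- step remains.
    refine ⟨blockV ω f₂ ((blockAZero h ^ k) x), ?_⟩
    rw [pow_succ', pow_succ', Module.End.mul_apply, Module.End.mul_apply, hc, map_add, map_smul,
      h0, smul_zero, zero_add, block_apply h]

/-- `A` is nilpotent on `W₀` if `f₂` is in its kernel. -/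
theorem exists_pow_eq_zero_of_mem_genW (h : IsAdapted ω f₂) (h0 : A f₂ = 0) {w : 𝔲}
    (hw : w ∈ genW h) : ∃ k, (A ^ k) w = 0 := by
  obtain ⟨a, ha, b, ⟨x, hx, rfl⟩, rfl⟩ := Submodule.mem_sup.1 hw
  obtain ⟨c, rfl⟩ := Submodule.mem_span_singleton.1 ha
  obtain ⟨k, hk⟩ := (Module.End.mem_maxGenEigenspace _ _ _).1 hx
  rw [zero_smul, sub_zero] at hk
  obtain ⟨d, hd⟩ := exists_pow_apply_eq_smul_add h h0 k x
  -- Once `A₀ ^ k` kills `x`, `A ^ k` sends it into `ℝ f₂`; one further application of `A` gives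
  -- zero.
  refine ⟨k + 1, ?_⟩
  rw [hk, Submodule.coe_zero, add_zero] at hd
  rw [map_add, map_smul, pow_succ, Module.End.mul_apply, h0, map_zero, smul_zero, zero_add,
    ← pow_succ, pow_succ', Module.End.mul_apply, Submodule.subtype_apply, hd, map_smul, h0,
    smul_zero]

theorem blockM_ne_zero (h : IsAdapted ω f₂)
    (hv : (blockV ω f₂).domRestrict (genV h) ≠ 0) : blockM h ≠ 0 := by
  contrapose! hv
  ext x
  have hx : (x : 𝔲) ∈ genW h := Submodule.mem_sup_right ⟨x, x.2, rfl⟩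
  have hAx : A (x : 𝔲) = 0 := congr($hv ⟨_, hx⟩)
  change fTwoCoord ω (A x) = 0
  rw [hAx, map_zero]

end Splitting

end LieForms

/-- A vector that is killed by a power of an endomorphism but not by the endomorphism itself yields
a Jordan chain of length two. -/
theorem Module.End.exists_apply_ne_zero_of_pow_eq_zero {V : Type*} [AddCommGroup V] [Module ℝ V]
    (A : Module.End ℝ V) {w : V} (hw : A w ≠ 0) {k : ℕ} (hk : (A ^ k) w = 0) :
    ∃ u, A u ≠ 0 ∧ A (A u) = 0 := by
  induction k generalizing w with
  | zero => exact absurd (by rw [show w = 0 from hk, map_zero]) hw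
  | succ k ih =>
    by_cases h : A (A w) = 0
    · exact ⟨w, hw, h⟩
    · exact ih h (by rwa [pow_succ] at hk)

end

theorem theorem4p12 {𝔲 : Type*} [AddCommGroup 𝔲] [Module ℝ 𝔲] [Module.Finite ℝ 𝔲]
    (A : Module.End ℝ 𝔲)
    (hA : LieForms.IsUnimodular (LieForms.AlmostAbelian A))
    (ω₀ : LieForms.SymplecticForm (LieForms.AlmostAbelian A))
    (f₂ : 𝔲) (hf₂ : LieForms.IsAdapted ω₀ f₂)
    (h0 : (0 : ℝ) ∈ spectrum ℝ (LieForms.blockAZero hf₂)) :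
    ((LieForms.blockV ω₀ f₂).domRestrict (LieForms.genV hf₂) ≠ 0 → LieForms.blockM hf₂ ≠ 0) ∧
    (LieForms.blockM hf₂ ≠ 0 →
      ∀ ω : LieForms.SymplecticForm (LieForms.AlmostAbelian A),
        ¬ ω.HardLefschetz ∧ ω.FailsAtDegree 1) := by
  refine ⟨LieForms.blockM_ne_zero hf₂, fun hM ω => ?_⟩
  obtain ⟨w, hw⟩ : ∃ w, LieForms.blockM hf₂ w ≠ 0 := by
    by_contra! h
    exact hM (LinearMap.ext h)
  obtain ⟨k, hk⟩ :=
    LieForms.exists_pow_eq_zero_of_mem_genW hf₂ (hf₂.map_eq_zero hA) w.2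
  obtain ⟨u, hu, hu'⟩ := A.exists_apply_ne_zero_of_pow_eq_zero (w := w) hw hk
  have hfail := LieForms.AlmostAbelian.failsAtDegree_one hA ω hu hu'
  exact ⟨hfail.not_hardLefschetz, hfail⟩
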